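/- **Setting.** Let $G$ be a 3-dimensional Lie group with Lie algebra $\mathfrak g$ and a left-invariant Riemannian metric $g$. Let $\nabla$ be the Levi-Civita connection of $g$. Fix a $g$-orthonormal basis $(e_1,e_2,e_3)$ of $\mathfrak g$ (which fixes an orientation), and denote the corresponding left-invariant vector fields by the same symbols. Put $x=\tfrac1{\sqrt2}(e_2-ie_3)$, $y=\tfrac1{\sqrt2}(e_2+ie_3)$ in $\mathfrak g^{\mathbb C}$, and let $\Sigma=\Lambda^\bullet(\mathbb C y)$ be the spin module, with Clifford multiplication $$e_1\cdot\eta=i(\eta_{\rm even}-\eta_{\rm odd}),\qquad e_2\cdot\eta=i(x\lrcorner\eta+y\wedge\eta),\qquad e_3\cdot\eta=y\wedge\eta-x\lrcorner\eta .$$ The spinor bundle of the $G$-invariant spin structure is $G\times\Sigma$. A spinor is a smooth map $\psi\colon G\to\Sigma$; its spin covariant derivative is $$\widetilde\nabla_X\psi=d\psi(X)+\tfrac12\sum_{i<j}g(\nabla_Xe_i,e_j)\,e_i\cdot e_j\cdot\psi .$$ A spinor $\psi$ is *invariant* if $\psi(a^{-1}b)=\psi(b)$ for all $a,b\in G$,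 that is, if it is constant; thus invariant spinors are identified with elements of $\Sigma$. A spinor $\psi$ is *generalised Killing with endomorphism $A$* if $A$ is a smooth field of $g$-symmetric endomorphisms of $TG$ and $\widetilde\nabla_X\psi=A(X)\cdot\psi$ for every tangent vector $X$. **Lemma 4.1.** Suppose that some non-zero invariant spinor is generalised Killing with endomorphism $A$. Then every invariant spinor is generalised Killing with the same endomorphism $A$. Hence the set of invariant generalised Killing spinors (each with some endomorphism) is, as a subset of $\Sigma$, a complex vector subspace, and it is either $0$ or all of $\Sigma$. -/

import Mathlib

open Bundle
open scoped Manifold ContDiff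

namespace LieSpin

noncomputable section

/-! ### The spin representation in dimension three

With respect to an orthonormal basis `e₁, e₂, e₃` of the Lie algebra (indexed below by `0, 1, 2`),
put `x = (e₂ - i e₃) / √2` and `y = (e₂ + i e₃) / √2`.  The spin module is `Σ = Λ^• L'`, where `L'`
is the complex line spanned by `y`.  The line `L'` is identified with `ℂ` by `y ↔ 1`; the
functional `z ↦ B(x, z)` on `L'` is then the identity of `ℂ`, because `B(x, y) = 1`. -/

/-- The spin module `Σ = Λ^• L'`, with `L' = ℂ y`. -/
abbrev SpinModule : Type := ExteriorAlgebra ℂ ℂ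

/-- Coordinates on `Σ` with respect to its complex basis `1, y`. -/
def spinCoord : SpinModule →ₗ[ℂ] ℂ × ℂ where
  toFun η := ((CliffordAlgebraDualNumber.equiv (R := ℂ) η).fst,
    (CliffordAlgebraDualNumber.equiv (R := ℂ) η).snd)
  map_add' _ _ := by simp
  map_smul' _ _ := by simp

theorem spinCoord_injective : Function.Injective spinCoord := by
  intro a b h
  simp only [spinCoord, LinearMap.coe_mk, AddHom.coe_mk, Prod.mk.injEq] at h
  exact (CliffordAlgebraDualNumber.equiv (R := ℂ)).injective (TrivSqZeroExt.ext h.1 h.2)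

/-- A norm on the finite-dimensional space `Σ`, which is used only to differentiate maps into it
(all norms on `Σ` give the same derivatives). -/
instance : NormedAddCommGroup SpinModule :=
  NormedAddCommGroup.induced SpinModule (ℂ × ℂ) spinCoord spinCoord_injective

instance : NormedSpace ℂ SpinModule :=
  NormedSpace.induced ℂ SpinModule (ℂ × ℂ) spinCoord

/-- `y ∧ η`. -/
def wedgeY : SpinModule →ₗ[ℂ] SpinModule :=
  LinearMap.mulLeft ℂ (ExteriorAlgebra.ι ℂ (1 : ℂ))

/-- The interior product `x ⌟ η`. -/
def contractX : SpinModule →ₗ[ℂ] SpinModule :=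
  CliffordAlgebra.contractLeft (LinearMap.id : Module.Dual ℂ ℂ)

/-- `η ↦ η_even - η_odd`. -/
def gradeSign : SpinModule →ₗ[ℂ] SpinModule :=
  (CliffordAlgebra.involute (Q := (0 : QuadraticForm ℂ ℂ))).toLinearMap

/-- Clifford multiplication by the vectors `e₁, e₂, e₃` of the orthonormal basis:
`e₁ · η = i (η_even - η_odd)`, `e₂ · η = i (x ⌟ η + y ∧ η)`, `e₃ · η = y ∧ η - x ⌟ η`. -/
def gammaMap : Fin 3 → (SpinModule →ₗ[ℂ] SpinModule) :=
  ![Complex.I • gradeSign, Complex.I • (contractX + wedgeY), wedgeY - contractX]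

/-! ### Spinor fields and the Levi-Civita connection on a three-dimensional Lie group -/

section Group

variable {G : Type*} [TopologicalSpace G] [ChartedSpace (EuclideanSpace ℝ (Fin 3)) G] [Group G]

/-- The action of `G` on spinors, that is, on sections of the trivial bundle `G × Σ`:
`(x · ψ)(y) = ψ (x⁻¹ y)`. -/
def translate (x : G) (ψ : G → SpinModule) : G → SpinModule := fun y => ψ (x⁻¹ * y)

/-- A spinor is invariant if it is stabilised by every element of `G`. -/
def IsInvariantSpinor (ψ : G → SpinModule) : Prop := ∀ x : G, translate x ψ = ψ

variable [LieGroup (𝓡 3) ∞ G]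

set_option synthInstance.maxHeartbeats 200000 in
instance instIsManifoldTwo : IsManifold (𝓡 3) 2 G := inferInstance

set_option synthInstance.maxHeartbeats 200000 in
instance instIsManifoldOne : IsManifold (𝓡 3) 1 G := inferInstance

/-- A smooth Riemannian metric on `G`. -/
abbrev Metric (G : Type*) [TopologicalSpace G] [ChartedSpace (EuclideanSpace ℝ (Fin 3)) G]
    [Group G] [LieGroup (𝓡 3) ∞ G] : Type _ :=
  ContMDiffRiemannianMetric (𝓡 3) ∞ (EuclideanSpace ℝ (Fin 3))
    (fun x : G => TangentSpace (𝓡 3) x)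

/-- An affine connection on `G`: a covariant derivative on the tangent bundle, where
`D Y x v` stands for `(D_v Y)(x)`. -/
abbrev Connection (G : Type*) [TopologicalSpace G] [ChartedSpace (EuclideanSpace ℝ (Fin 3)) G]
    [Group G] [LieGroup (𝓡 3) ∞ G] : Type _ :=
  CovariantDerivative (𝓡 3) (EuclideanSpace ℝ (Fin 3)) (fun x : G => TangentSpace (𝓡 3) x)

/-- The Riemannian metric `g` is left-invariant: left translations are isometries. -/
def IsLeftInvariantMetric (g : Metric G) : Prop :=
  ∀ (a x : G) (v w : TangentSpace (𝓡 3) x),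
    g.inner (a * x) (mfderiv (𝓡 3) (𝓡 3) (a * ·) x v) (mfderiv (𝓡 3) (𝓡 3) (a * ·) x w) =
      g.inner x v w

/-- `D` is compatible with the metric `g`. -/
def IsMetricConnection (g : Metric G) (D : Connection G) : Prop :=
  letI : RiemannianBundle (fun x : G => TangentSpace (𝓡 3) x) := ⟨g.toRiemannianMetric⟩
  haveI : IsContMDiffRiemannianBundle (𝓡 3) 1 (EuclideanSpace ℝ (Fin 3))
    (fun x : G => TangentSpace (𝓡 3) x) := IsContMDiffRiemannianBundle.of_le (n := ∞) (by simp)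
  CovariantDerivative.IsMetricCompatible D

/-- `D` is the Levi-Civita connection of `g`: it is compatible with `g` and torsion-free. -/
structure IsLeviCivita (g : Metric G) (D : Connection G) : Prop where
  metric : IsMetricConnection g D
  torsion_free : D.torsion = 0

/-! ### The spin connection and generalised Killing spinors

Throughout, `e` is a `g`-orthonormal basis of the Lie algebra `T₁G`; it determines the orientation
of `G` and the identification of the spinor bundle of the invariant spin structure with `G × Σ`. -/

/-- `e` is orthonormal for the inner product `g₁` on the Lie algebra `T₁G`.  As the Lie algebra is
three-dimensional, `e` is then an orthonormal basis of it. -/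
def IsOrthonormal (g : Metric G) (e : Fin 3 → GroupLieAlgebra (𝓡 3) G) : Prop :=
  ∀ i j : Fin 3, g.inner 1 (e i) (e j) = if i = j then 1 else 0

/-- The left-invariant vector field with value `e i` at the identity. -/
def frame (e : Fin 3 → GroupLieAlgebra (𝓡 3) G) (i : Fin 3) (x : G) : TangentSpace (𝓡 3) x :=
  mulInvariantVectorField (e i) x

/-- Clifford multiplication `v · s` of `s ∈ Σ` by a tangent vector `v` at `x`. -/
def cliffordMul (g : Metric G) (e : Fin 3 → GroupLieAlgebra (𝓡 3) G) (x : G)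
    (v : TangentSpace (𝓡 3) x) (s : SpinModule) : SpinModule :=
  ∑ i : Fin 3, ((g.inner x v (frame e i x) : ℝ) : ℂ) • gammaMap i s

/-- The differential of `ψ : G → Σ` at `x` in the direction `v`. -/
def spinorDeriv (ψ : G → SpinModule) (x : G) (v : TangentSpace (𝓡 3) x) : SpinModule :=
  mfderiv (𝓡 3) 𝓘(ℝ, SpinModule) ψ x v

/-- The spin connection on `G × Σ` induced by a metric connection `D` on `TG`.  For a tangent
vector `v` at `x` it is `dψ(v) + 1/2 ∑_{i<j} g(D_v eᵢ, eⱼ) eᵢ · eⱼ · ψ(x)`, where the `eᵢ` are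
extended to left-invariant vector fields; that is, the connection form of `D` in this frame is
lifted by the isomorphism `𝔰𝔬(3) → 𝔰𝔭𝔦𝔫(3)`, `eᵢ ∧ eⱼ ↦ 1/2 eᵢ · eⱼ`. -/
def spinConnection (g : Metric G) (D : Connection G) (e : Fin 3 → GroupLieAlgebra (𝓡 3) G)
    (ψ : G → SpinModule) (x : G) (v : TangentSpace (𝓡 3) x) : SpinModule :=
  spinorDeriv ψ x v +
    (1 / 2 : ℂ) • ∑ i : Fin 3, ∑ j ∈ Finset.Ioi i,
      ((g.inner x (D (frame e i) x v) (frame e j x) : ℝ) : ℂ) • gammaMap i (gammaMap j (ψ x))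

/-- An endomorphism field of the tangent bundle of `G`. -/
abbrev EndField (G : Type*) [TopologicalSpace G] [ChartedSpace (EuclideanSpace ℝ (Fin 3)) G] :
    Type _ :=
  (x : G) → TangentSpace (𝓡 3) x →L[ℝ] TangentSpace (𝓡 3) x

/-- The endomorphism field `A` is a smooth section of `End(TG)`. -/
def IsSmoothEndField (A : EndField G) : Prop :=
  ContMDiff (𝓡 3)
    ((𝓡 3).prod 𝓘(ℝ, EuclideanSpace ℝ (Fin 3) →L[ℝ] EuclideanSpace ℝ (Fin 3))) ∞
    (fun x : G => (TotalSpace.mk' (EuclideanSpace ℝ (Fin 3) →L[ℝ] EuclideanSpace ℝ (Fin 3)) x (A x) :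
        TotalSpace (EuclideanSpace ℝ (Fin 3) →L[ℝ] EuclideanSpace ℝ (Fin 3))
          (fun x : G => TangentSpace (𝓡 3) x →L[ℝ] TangentSpace (𝓡 3) x)))

/-- The spinor `ψ` is generalised Killing with endomorphism field `A`: `ψ` is smooth, `A` is a
smooth field of `g`-symmetric endomorphisms of `TG`, and the spin covariant derivative of `ψ` in
the direction of any tangent vector `v` is `A(v) · ψ`.  Here `D` is meant to be the Levi-Civita
connection of `g` and `e` an orthonormal basis of the Lie algebra. -/
structure IsGeneralisedKilling (g : Metric G) (D : Connection G)
    (e : Fin 3 → GroupLieAlgebra (𝓡 3) G) (ψ : G → SpinModule) (A : EndField G) : Prop where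
  smooth_spinor : ContMDiff (𝓡 3) 𝓘(ℝ, SpinModule) ∞ ψ
  smooth_endo : IsSmoothEndField A
  symmetric : ∀ (x : G) (v w : TangentSpace (𝓡 3) x), g.inner x (A x v) w = g.inner x v (A x w)
  equation : ∀ (x : G) (v : TangentSpace (𝓡 3) x),
    spinConnection g D e ψ x v = cliffordMul g e x (A x v) (ψ x)

end Group

end

end LieSpin

/-!
Under Clifford multiplication `e₁, e₂, e₃` act on `Σ` as the quaternion units `i, j, k`, so `Σ` is
a module over the division ring `ℍ`.  Vectors of `ℝ³` act as imaginary quaternions, and so do the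
elements `½ eᵢ · eⱼ` of `𝔰𝔭𝔦𝔫(3)`.  For a constant spinor `s` the generalised Killing equation
therefore reads `p • s = q • s`, where the quaternions `p` (from the connection) and `q` (from `A`)
do not depend on `s`.  If `s ≠ 0` this forces `p = q`, and then every constant spinor satisfies it.
-/

namespace LieSpin

open scoped Quaternion

theorem exteriorAlgebra_self_linearMap_ext {R N : Type*} [CommRing R] [AddCommMonoid N]
    [Module R N] {f f' : ExteriorAlgebra R R →ₗ[R] N} (h_one : f 1 = f' 1)
    (h_ι : f (ExteriorAlgebra.ι R 1) = f' (ExteriorAlgebra.ι R 1)) : f = f' := by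
  let E := CliffordAlgebraDualNumber.equiv (R := R)
  have h_eps : E.symm DualNumber.eps = ExteriorAlgebra.ι R 1 :=
    CliffordAlgebraDualNumber.equiv_symm_eps
  have h_comp : f ∘ₗ E.symm.toLinearMap = f' ∘ₗ E.symm.toLinearMap := by
    refine TrivSqZeroExt.linearMap_ext (fun r => ?_) fun m => ?_
    · have h_inl : (TrivSqZeroExt.inl r : DualNumber R) = r • 1 := by ext <;> simp
      simp [h_inl, h_one]
    · have h_inr : (TrivSqZeroExt.inr m : DualNumber R) = m • DualNumber.eps := by ext <;> simp
      rw [h_inr]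
      simp [h_eps, h_ι]
  ext η
  simpa using LinearMap.congr_fun h_comp (E η)

@[simp]
theorem gradeSign_one : gradeSign 1 = 1 :=
  map_one (CliffordAlgebra.involute (Q := (0 : QuadraticForm ℂ ℂ)))

@[simp]
theorem gradeSign_ι (z : ℂ) : gradeSign (ExteriorAlgebra.ι ℂ z) = -ExteriorAlgebra.ι ℂ z :=
  CliffordAlgebra.involute_ι z

@[simp]
theorem wedgeY_one : wedgeY 1 = ExteriorAlgebra.ι ℂ (1 : ℂ) :=
  mul_one _

@[simp]
theorem wedgeY_ι_one : wedgeY (ExteriorAlgebra.ι ℂ (1 : ℂ)) = 0 :=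
  ExteriorAlgebra.ι_sq_zero 1

@[simp]
theorem contractX_one : contractX 1 = 0 :=
  CliffordAlgebra.contractLeft_one (Q := (0 : QuadraticForm ℂ ℂ)) LinearMap.id

@[simp]
theorem contractX_ι (z : ℂ) : contractX (ExteriorAlgebra.ι ℂ z) = algebraMap ℂ SpinModule z :=
  CliffordAlgebra.contractLeft_ι (Q := (0 : QuadraticForm ℂ ℂ)) LinearMap.id z

/-- Clifford multiplication by `e₁, e₂, e₃` as a system `i, j, k` of quaternion units; the
orientation enters as `e₁ · e₂ · = e₃ ·`. -/
noncomputable def gammaQuaternionBasis :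
    QuaternionAlgebra.Basis (Module.End ℂ SpinModule) (-1 : ℝ) 0 (-1) where
  i := gammaMap 0
  j := gammaMap 1
  k := gammaMap 2
  i_mul_i := by
    apply exteriorAlgebra_self_linearMap_ext <;> simp [gammaMap, smul_smul]
  j_mul_j := by
    apply exteriorAlgebra_self_linearMap_ext <;> simp [gammaMap, smul_smul]
  i_mul_j := by
    apply exteriorAlgebra_self_linearMap_ext <;> simp [gammaMap, smul_smul]
  j_mul_i := by
    apply exteriorAlgebra_self_linearMap_ext <;> simp [gammaMap, smul_smul]

/-- The quaternionic structure of `Σ`, in which `i, j, k` are Clifford multiplication by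
`e₁, e₂, e₃`. -/
noncomputable instance instModuleQuaternion : Module ℍ[ℝ] SpinModule :=
  Module.compHom SpinModule gammaQuaternionBasis.liftHom.toRingHom

theorem quaternion_smul_def (q : ℍ[ℝ]) (s : SpinModule) :
    q • s = (q.re : ℂ) • s + (q.imI : ℂ) • gammaMap 0 s + (q.imJ : ℂ) • gammaMap 1 s +
      (q.imK : ℂ) • gammaMap 2 s :=
  rfl

theorem isInvariantSpinor_iff {G : Type*} [Group G] {ψ : G → SpinModule} :
    IsInvariantSpinor ψ ↔ ∃ s, ψ = fun _ => s := by
  refine ⟨fun h => ⟨ψ 1, funext fun x => ?_⟩, ?_⟩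
  · simpa [translate] using congrFun (h x⁻¹) 1
  · rintro ⟨s, rfl⟩ x
    rfl

section Group

variable {G : Type*} [TopologicalSpace G] [ChartedSpace (EuclideanSpace ℝ (Fin 3)) G] [Group G]
  [LieGroup (𝓡 3) ∞ G]

/-- The imaginary quaternion through which a tangent vector `v` acts on `Σ` by Clifford
multiplication. -/
noncomputable def vectorQuaternion (g : Metric G) (e : Fin 3 → GroupLieAlgebra (𝓡 3) G) (x : G)
    (v : TangentSpace (𝓡 3) x) : ℍ[ℝ] :=
  ⟨0, g.inner x v (frame e 0 x), g.inner x v (frame e 1 x), g.inner x v (frame e 2 x)⟩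

/-- The imaginary quaternion through which the connection form of `D` at a tangent vector `v`,
lifted to `𝔰𝔭𝔦𝔫(3) = Im ℍ`, acts on `Σ`: as `e₂ · e₃ · = e₁ ·`, `e₁ · e₃ · = -e₂ ·` and
`e₁ · e₂ · = e₃ ·`, its components are `½ ω₂₃`, `-½ ω₁₃`, `½ ω₁₂` with `ωᵢⱼ = g(D_v eᵢ, eⱼ)`. -/
noncomputable def connectionQuaternion (g : Metric G) (D : Connection G)
    (e : Fin 3 → GroupLieAlgebra (𝓡 3) G) (x : G) (v : TangentSpace (𝓡 3) x) : ℍ[ℝ] :=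
  ⟨0, g.inner x (D (frame e 1) x v) (frame e 2 x) / 2,
    -g.inner x (D (frame e 0) x v) (frame e 2 x) / 2,
    g.inner x (D (frame e 0) x v) (frame e 1 x) / 2⟩

variable {g : Metric G} {D : Connection G} {e : Fin 3 → GroupLieAlgebra (𝓡 3) G}

theorem cliffordMul_eq_smul (x : G) (v : TangentSpace (𝓡 3) x) (s : SpinModule) :
    cliffordMul g e x v s = vectorQuaternion g e x v • s := by
  rw [quaternion_smul_def]
  simp [cliffordMul, vectorQuaternion, Fin.sum_univ_three]

theorem spinConnection_const (x : G) (v : TangentSpace (𝓡 3) x) (s : SpinModule) :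
    spinConnection g D e (fun _ => s) x v = connectionQuaternion g D e x v • s := by
  have h_deriv : spinorDeriv (fun _ : G => s) x v = 0 := by
    rw [spinorDeriv, mfderiv_const]
    rfl
  have h01 : gammaMap 0 (gammaMap 1 s) = gammaMap 2 s :=
    LinearMap.congr_fun gammaQuaternionBasis.i_mul_j s
  have h02 : gammaMap 0 (gammaMap 2 s) = -gammaMap 1 s := by
    simpa [gammaQuaternionBasis] using LinearMap.congr_fun gammaQuaternionBasis.i_mul_k s
  have h12 : gammaMap 1 (gammaMap 2 s) = gammaMap 0 s := by
    simpa [gammaQuaternionBasis] using LinearMap.congr_fun gammaQuaternionBasis.j_mul_k s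
  have hIoi : Finset.Ioi (0 : Fin 3) = {1, 2} ∧ Finset.Ioi (1 : Fin 3) = {2} ∧
      Finset.Ioi (2 : Fin 3) = ∅ := by decide
  rw [quaternion_smul_def]
  simp only [spinConnection, h_deriv, connectionQuaternion, Fin.sum_univ_three, hIoi,
    Finset.sum_empty, Finset.sum_singleton, Finset.sum_pair (show (1 : Fin 3) ≠ 2 by decide),
    h01, h02, h12, Complex.coe_smul]
  module

theorem IsGeneralisedKilling.const_of_ne_zero {A : EndField G} {s : SpinModule} (hs : s ≠ 0)
    (h : IsGeneralisedKilling g D e (fun _ => s) A) (t : SpinModule) :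
    IsGeneralisedKilling g D e (fun _ => t) A where
  smooth_spinor := contMDiff_const
  smooth_endo := h.smooth_endo
  symmetric := h.symmetric
  equation x v := by
    have h_smul : connectionQuaternion g D e x v • s = vectorQuaternion g e x (A x v) • s := by
      simpa only [spinConnection_const, cliffordMul_eq_smul] using h.equation x v
    rw [spinConnection_const, cliffordMul_eq_smul, smul_left_injective ℍ[ℝ] hs h_smul]

theorem isGeneralisedKilling_zero (g : Metric G) (D : Connection G)
    (e : Fin 3 → GroupLieAlgebra (𝓡 3) G) :
    IsGeneralisedKilling g D e (fun _ => 0) (fun _ => 0) where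
  smooth_spinor := contMDiff_const
  smooth_endo := Bundle.contMDiff_zeroSection ℝ
    (fun x : G => TangentSpace (𝓡 3) x →L[ℝ] TangentSpace (𝓡 3) x)
  symmetric x v w := by simp
  equation x v := by rw [spinConnection_const, cliffordMul_eq_smul, smul_zero, smul_zero]

/-- The space of invariant generalised Killing spinors, an invariant spinor being identified with
its constant value in `Σ`. -/
def invariantKillingSpinors (g : Metric G) (D : Connection G)
    (e : Fin 3 → GroupLieAlgebra (𝓡 3) G) : Submodule ℂ SpinModule where
  carrier := {s | ∃ A, IsGeneralisedKilling g D e (fun _ => s) A}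
  zero_mem' := ⟨_, isGeneralisedKilling_zero g D e⟩
  add_mem' := by
    rintro s t ⟨A, hA⟩ ht
    rcases eq_or_ne s 0 with rfl | hs
    · rwa [zero_add]
    · exact ⟨A, hA.const_of_ne_zero hs (s + t)⟩
  smul_mem' := by
    rintro c s ⟨A, hA⟩
    rcases eq_or_ne s 0 with rfl | hs
    · exact ⟨A, by rwa [smul_zero]⟩
    · exact ⟨A, hA.const_of_ne_zero hs (c • s)⟩

theorem mem_invariantKillingSpinors {s : SpinModule} :
    s ∈ invariantKillingSpinors g D e ↔ ∃ A, IsGeneralisedKilling g D e (fun _ => s) A :=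
  Iff.rfl

theorem invariantKillingSpinors_eq_bot_or_eq_top :
    invariantKillingSpinors g D e = ⊥ ∨ invariantKillingSpinors g D e = ⊤ := by
  refine or_iff_not_imp_left.2 fun h => ?_
  obtain ⟨s, ⟨A, hA⟩, hs⟩ := Submodule.exists_mem_ne_zero_of_ne_bot h
  exact eq_top_iff.2 fun t _ => ⟨A, hA.const_of_ne_zero hs t⟩

end Group

end LieSpin

open LieSpin in
theorem lemma4p1_general
    {G : Type*} [TopologicalSpace G] [ChartedSpace (EuclideanSpace ℝ (Fin 3)) G] [Group G]
    [LieGroup (𝓡 3) ∞ G]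
    (g : Metric G) (hg : IsLeftInvariantMetric g)
    (D : Connection G) (hD : IsMetricConnection g D)
    (e : Fin 3 → GroupLieAlgebra (𝓡 3) G) (he : IsOrthonormal g e) :
    (∀ A : EndField G,
      (∃ ψ : G → SpinModule,
        IsInvariantSpinor ψ ∧ ψ ≠ 0 ∧ IsGeneralisedKilling g D e ψ A) →
      ∀ φ : G → SpinModule, IsInvariantSpinor φ → IsGeneralisedKilling g D e φ A) ∧
    ∃ W : Submodule ℂ SpinModule,
      (∀ ψ : G → SpinModule,
        (IsInvariantSpinor ψ ∧ ∃ A : EndField G, IsGeneralisedKilling g D e ψ A) ↔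
          ∃ s ∈ W, ψ = fun _ => s) ∧
      (W = ⊥ ∨ W = ⊤) := by
  refine ⟨?_, invariantKillingSpinors g D e, fun ψ => ⟨?_, ?_⟩,
    invariantKillingSpinors_eq_bot_or_eq_top⟩
  · rintro A ⟨ψ, hψ, hψ_ne, hA⟩ φ hφ
    obtain ⟨s, rfl⟩ := isInvariantSpinor_iff.1 hψ
    obtain ⟨t, rfl⟩ := isInvariantSpinor_iff.1 hφ
    exact hA.const_of_ne_zero (fun hs => hψ_ne (funext fun _ => hs)) t
  · rintro ⟨hψ, hA⟩
    obtain ⟨s, rfl⟩ := isInvariantSpinor_iff.1 hψ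
    exact ⟨s, mem_invariantKillingSpinors.2 hA, rfl⟩
  · rintro ⟨s, hs, rfl⟩
    exact ⟨isInvariantSpinor_iff.2 ⟨s, rfl⟩, mem_invariantKillingSpinors.1 hs⟩

open LieSpin in
theorem lemma4p1
    {G : Type*} [TopologicalSpace G] [ChartedSpace (EuclideanSpace ℝ (Fin 3)) G] [Group G]
    [LieGroup (𝓡 3) ∞ G]
    (g : Metric G) (hg : IsLeftInvariantMetric g)
    (D : Connection G) (hD : IsLeviCivita g D)
    (e : Fin 3 → GroupLieAlgebra (𝓡 3) G) (he : IsOrthonormal g e) :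
    (∀ A : EndField G,
      (∃ ψ : G → SpinModule,
        IsInvariantSpinor ψ ∧ ψ ≠ 0 ∧ IsGeneralisedKilling g D e ψ A) →
      ∀ φ : G → SpinModule, IsInvariantSpinor φ → IsGeneralisedKilling g D e φ A) ∧
    ∃ W : Submodule ℂ SpinModule,
      (∀ ψ : G → SpinModule,
        (IsInvariantSpinor ψ ∧ ∃ A : EndField G, IsGeneralisedKilling g D e ψ A) ↔
          ∃ s ∈ W, ψ = fun _ => s) ∧
      (W = ⊥ ∨ W = ⊤) :=
  lemma4p1_general g hg D hD.metric e he
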